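/- Let $F$ be a nonarchimedean local field of residual characteristic $\neq 2$, with normalized valuation $\mathrm{val}$, let $\varpi\in F$ be a uniformizer and $\varepsilon\in F^\times$ a nonsquare unit. Let $G=\mathrm{SL}(2,F)$ and $\mathfrak g=\mathfrak{sl}(2,F)$, identified with its dual by the trace form, and let $G$ act on $\mathfrak g$ by conjugation. An element of $\mathfrak g$ is *semisimple* if its $G$-orbit is closed and *nilpotent* if the closure of its $G$-orbit contains $0$. For a point $x$ of the Bruhat–Tits building $\mathcal B(G)$ let $\mathfrak g_{x,r}$ ($r\in\mathbb R$) be the Moy–Prasad filtration of $\mathfrak g$ and $\mathfrak g_{x,r+}=\bigcup_{s>r}\mathfrak g_{x,s}$. For $0\ne\Gamma\in\mathfrak g$ let $d_x(\Gamma)$ be the real number $t$ with $\Gamma\in\mathfrak g_{x,t}\setminus\mathfrak g_{x,t+}$, and let $d(\Gamma)=\sup_x d_x(\Gamma)\in\mathbb R\cup\{\infty\}$. If $d=d_x(\Gamma)<d(\Gamma)$, let $\mathcal O(\Gamma,x)$ be the unique minimal nilpotent orbit, for the closure relation, meeting $\Gamma+\mathfrak g_{x,d+}$. The nilpotent support of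 $\Gamma$ is $$\mathrm{nil}(\Gamma)=\{\mathcal O(\Gamma,x)\mid x\in\mathcal B(G),\ d_x(\Gamma)<d(\Gamma)\}.$$ For $u\in F^\times$ let $\mathcal O_u$ be the $G$-orbit of $\begin{pmatrix}0&u\\0&0\end{pmatrix}$. Say that $\Gamma$ splits over a field $E\supseteq F$ if it is conjugate under $\mathrm{SL}(2,E)$ to a diagonal matrix. **Lemma.** Let $\Gamma\in\mathfrak g\setminus\{0\}$ be semisimple. 1. If $\Gamma$ splits over $F$, then $\mathrm{nil}(\Gamma)=\{\mathcal O_1,\mathcal O_\varepsilon,\mathcal O_\varpi,\mathcal O_{\varepsilon\varpi}\}$. 2. Otherwise, $\Gamma$ is $G$-conjugate to $\begin{pmatrix}0&u\\v&0\end{pmatrix}$ for some $u,v\in F^\times$. For any such $u,v$, put $E=F(\sqrt{uv})$. Then $\Gamma$ splits over $E$; the elements $u$ and $v$ are each uniquely determined by $\Gamma$ modulo $N_{E/F}(E^\times)$; the group $N_{E/F}(E^\times)/(F^\times)^2$ has exactly two elements; and if $\{1,\gamma\}$ is a set of representatives of it, then $\mathrm{nil}(\Gamma)=\{\mathcal O_u,\mathcal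 O_{u\gamma}\}$. -/

import Mathlib

open ValuativeRel

namespace SL2Support

/-! ## The group `SL(2, K)`, its Lie algebra and the adjoint action -/

section Adjoint

/-- The group `SL(2, K)`. -/
abbrev SL2 (K : Type*) [Field K] := Matrix.SpecialLinearGroup (Fin 2) K

/-- The Lie algebra `sl(2, K)` of traceless matrices. -/
abbrev sl2 (K : Type*) [Field K] := ↥(LieAlgebra.SpecialLinear.sl (Fin 2) K)

variable {K : Type*} [Field K]

theorem mem_sl_iff (X : Matrix (Fin 2) (Fin 2) K) :
    X ∈ LieAlgebra.SpecialLinear.sl (Fin 2) K ↔ X.trace = 0 := Iff.rfl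

/-- The adjoint action `X ↦ g X g⁻¹`. -/
def Ad (g : SL2 K) (X : sl2 K) : sl2 K :=
  ⟨(g : Matrix (Fin 2) (Fin 2) K) * X.1 * ((g⁻¹ : SL2 K) : Matrix (Fin 2) (Fin 2) K), by
    have hX : X.1.trace = 0 := X.2
    rw [mem_sl_iff, Matrix.trace_mul_comm, ← mul_assoc, ← Matrix.SpecialLinearGroup.coe_mul]
    simpa using hX⟩

theorem Ad_one (X : sl2 K) : Ad 1 X = X := by
  apply Subtype.ext
  simp [Ad]

theorem Ad_mul (g h : SL2 K) (X : sl2 K) : Ad (g * h) X = Ad g (Ad h X) := by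
  apply Subtype.ext
  simp only [Ad, mul_inv_rev, Matrix.SpecialLinearGroup.coe_mul, mul_assoc]

theorem sl2_apply_one_one (X : sl2 K) : X.1 1 1 = -X.1 0 0 := by
  have hX : X.1.trace = 0 := X.2
  rw [Matrix.trace_fin_two] at hX
  linear_combination hX

theorem Ad_val (g : SL2 K) (X : sl2 K) :
    (Ad g X).1 = g.1 * X.1 * !![g.1 1 1, -g.1 0 1; -g.1 1 0, g.1 0 0] := by
  simp only [Ad, Matrix.SpecialLinearGroup.coe_inv, Matrix.adjugate_fin_two]

/-- The diagonal torus element `diag(s, s⁻¹)`. -/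
def torusElt (s : Kˣ) : SL2 K :=
  ⟨!![(s : K), 0; 0, ((s⁻¹ : Kˣ) : K)], by simp [Matrix.det_fin_two]⟩

/-- The upper triangular unipotent with entry `b`. -/
def upperElt (b : K) : SL2 K := ⟨!![1, b; 0, 1], by simp [Matrix.det_fin_two]⟩

/-- The lower triangular unipotent with entry `c`. -/
def lowerElt (c : K) : SL2 K := ⟨!![1, 0; c, 1], by simp [Matrix.det_fin_two]⟩

/-- The element with upper right entry `s` and lower left entry `-s⁻¹`, normalizing the diagonal
torus. -/
def weylElt (s : Kˣ) : SL2 K :=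
  ⟨!![0, (s : K); -((s⁻¹ : Kˣ) : K), 0], by simp [Matrix.det_fin_two]⟩

theorem torusElt_inv (s : Kˣ) : (torusElt s)⁻¹ = torusElt s⁻¹ := by
  apply Subtype.ext
  rw [Matrix.SpecialLinearGroup.coe_inv]
  simp [torusElt, Matrix.adjugate_fin_two]

theorem weylElt_inv (s : Kˣ) : (weylElt s)⁻¹ = weylElt (-s) := by
  apply Subtype.ext
  rw [Matrix.SpecialLinearGroup.coe_inv]
  ext i j
  fin_cases i <;> fin_cases j <;>
    simp [weylElt, Matrix.adjugate_fin_two, inv_neg]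

theorem Ad_torusElt (s : Kˣ) (X : sl2 K) :
    (Ad (torusElt s) X).1 =
      !![X.1 0 0, s * s * X.1 0 1; (s⁻¹ : Kˣ) * (s⁻¹ : Kˣ) * X.1 1 0, X.1 1 1] := by
  rw [Ad_val]
  ext i j
  fin_cases i <;> fin_cases j <;>
    simp [torusElt, Matrix.mul_apply, Fin.sum_univ_two, Matrix.vecMul, dotProduct] <;>
    field_simp

theorem Ad_weylElt (s : Kˣ) (X : sl2 K) :
    (Ad (weylElt s) X).1 =
      !![-X.1 0 0, -(s * s * X.1 1 0); -((s⁻¹ : Kˣ) * (s⁻¹ : Kˣ) * X.1 0 1), X.1 0 0] := by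
  have h := sl2_apply_one_one X
  rw [Ad_val]
  ext i j
  fin_cases i <;> fin_cases j <;>
    simp [weylElt, Matrix.mul_apply, Fin.sum_univ_two, Matrix.vecMul, dotProduct, h] <;>
    field_simp

theorem Ad_upperElt (b : K) (X : sl2 K) :
    (Ad (upperElt b) X).1 =
      !![X.1 0 0 + b * X.1 1 0, X.1 0 1 + (-(b * X.1 0 0) + -(b * X.1 0 0) + -(b * b * X.1 1 0));
        X.1 1 0, -(X.1 0 0 + b * X.1 1 0)] := by
  have h := sl2_apply_one_one X
  rw [Ad_val]
  ext i j
  fin_cases i <;> fin_cases j <;>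
    simp [upperElt, Matrix.mul_apply, Fin.sum_univ_two, Matrix.vecMul, dotProduct, h] <;> ring

theorem Ad_lowerElt (c : K) (X : sl2 K) :
    (Ad (lowerElt c) X).1 =
      !![X.1 0 0 + -(c * X.1 0 1), X.1 0 1;
        X.1 1 0 + (c * X.1 0 0 + c * X.1 0 0 + -(c * c * X.1 0 1)),
        -(X.1 0 0 + -(c * X.1 0 1))] := by
  have h := sl2_apply_one_one X
  rw [Ad_val]
  ext i j
  fin_cases i <;> fin_cases j <;>
    simp [lowerElt, Matrix.mul_apply, Fin.sum_univ_two, Matrix.vecMul, dotProduct, h] <;> ring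

/-- The adjoint orbit of `X`. -/
def adOrbit (X : sl2 K) : Set (sl2 K) := Set.range fun g : SL2 K => Ad g X

/-- The traceless matrix with rows `(a, b)` and `(c, -a)`. -/
def tmat (a b c : K) : sl2 K :=
  ⟨!![a, b; c, -a], by rw [mem_sl_iff]; simp [Matrix.trace_fin_two]⟩

/-- The antidiagonal matrix with upper right entry `u` and lower left entry `v`. -/
def antidiag (u v : K) : sl2 K := tmat 0 u v

/-- The orbit `𝒪_u` of the matrix whose only nonzero entry is `u` in the upper right corner. -/
def orbitO (u : K) : Set (sl2 K) := adOrbit (tmat 0 u 0)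

/-- `Γ` splits over the extension `E` of `K`: over `E` it lies in the Lie algebra of a split
maximal torus, that is, of an `SL(2, E)`-conjugate of the diagonal torus. -/
def SplitsOver (E : Type*) [Field E] [Algebra K E] (X : sl2 K) : Prop :=
  ∃ (g : SL2 E) (a : E),
    X.1.map (algebraMap K E) = (Ad g (tmat a 0 0)).1

/-- `Γ` is semisimple: its orbit is closed. -/
def IsSemisimpleElt [TopologicalSpace K] (X : sl2 K) : Prop := IsClosed (adOrbit X)

/-- `X` is nilpotent: the closure of its orbit contains `0`. -/
def IsNilpotentElt [TopologicalSpace K] (X : sl2 K) : Prop := (0 : sl2 K) ∈ closure (adOrbit X)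

/-- The set of nilpotent orbits (the zero orbit included). -/
def nilpotentOrbits (K : Type*) [Field K] [TopologicalSpace K] : Set (Set (sl2 K)) :=
  {O | ∃ X : sl2 K, IsNilpotentElt X ∧ O = adOrbit X}

end Adjoint

/-! ## The valuation -/

section Val

variable {F : Type*} [Field F] [ValuativeRel F] [TopologicalSpace F]
  [IsNonarchimedeanLocalField F]

/-- The normalized additive valuation at nonzero elements (with the junk value `0` at `0`). -/
noncomputable def ord (x : F) : ℤ :=
  -WithZero.log (IsNonarchimedeanLocalField.valueGroupWithZeroIsoInt F (valuation F x))

/-- The normalized additive valuation, with `val 0 = ∞`. -/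
noncomputable def val (x : F) : EReal :=
  open Classical in if x = 0 then ⊤ else ((ord x : ℝ) : EReal)

theorem ord_mul {x y : F} (hx : x ≠ 0) (hy : y ≠ 0) : ord (x * y) = ord x + ord y := by
  unfold ord
  rw [map_mul, map_mul, WithZero.log_mul]
  · ring
  · simpa using hx
  · simpa using hy

theorem le_val_iff (r : ℝ) (x : F) : (r : EReal) ≤ val x ↔ (x ≠ 0 → r ≤ ord x) := by
  unfold val
  split_ifs with h
  · simp [h]
  · simp [h, EReal.coe_le_coe_iff]

theorem le_val_add {r : ℝ} {x y : F} (hx : (r : EReal) ≤ val x) (hy : (r : EReal) ≤ val y) :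
    (r : EReal) ≤ val (x + y) := by
  rw [le_val_iff] at *
  intro h
  by_cases hx0 : x = 0
  · subst hx0; simpa using hy (by simpa using h)
  by_cases hy0 : y = 0
  · subst hy0; simpa using hx (by simpa using h)
  have h1 := hx hx0
  have h2 := hy hy0
  have key : min (ord x) (ord y) ≤ ord (x + y) := by
    unfold ord
    rcases le_total (valuation F x) (valuation F y) with hxy | hxy
    · have h3 := (valuation F).map_add_le hxy le_rfl
      refine (min_le_right _ _).trans (neg_le_neg ?_)
      rw [WithZero.log_le_log (by simpa using h) (by simpa using hy0)]
      exact (OrderIsoClass.map_le_map_iff _).2 h3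
    · have h3 := (valuation F).map_add_le le_rfl hxy
      refine (min_le_left _ _).trans (neg_le_neg ?_)
      rw [WithZero.log_le_log (by simpa using h) (by simpa using hx0)]
      exact (OrderIsoClass.map_le_map_iff _).2 h3
  have key' : (min (ord x) (ord y) : ℝ) ≤ ord (x + y) := by exact_mod_cast key
  exact (le_min h1 h2).trans key'

theorem le_val_mul {r s t : ℝ} {x y : F} (hx : (r : EReal) ≤ val x) (hy : (s : EReal) ≤ val y)
    (h : t ≤ r + s) : (t : EReal) ≤ val (x * y) := by
  rw [le_val_iff] at *
  intro hxy
  have hx0 := left_ne_zero_of_mul hxy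
  have hy0 := right_ne_zero_of_mul hxy
  rw [ord_mul hx0 hy0]
  push_cast
  linarith [hx hx0, hy hy0]

theorem ord_neg (x : F) : ord (-x) = ord x := by
  simp [ord, Valuation.map_neg]

theorem val_neg (x : F) : val (-x) = val x := by
  unfold val
  by_cases h : x = 0 <;> simp [h, ord_neg]

theorem ord_one : ord (1 : F) = 0 := by simp [ord]

theorem val_one : val (1 : F) = 0 := by simp [val, ord_one]

end Val

/-! ## The Bruhat-Tits building of `SL(2, F)` and the Moy-Prasad filtration -/

section Building

variable {F : Type*} [Field F] [ValuativeRel F] [TopologicalSpace F]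
  [IsNonarchimedeanLocalField F]

/-- The standard apartment, that of the diagonal torus `S`, is the real line, a point `t` of it
being identified with the value at it of the positive root `α`, so that the affine roots are
`t ↦ t + n` and `t ↦ -t + n` with `n ∈ ℤ`. This is the Moy-Prasad lattice at `t`: the diagonal
part has valuation at least `r`, and the `±α`-part lies in the filtration pieces of the affine
roots `ψ` of gradient `±α` with `ψ(t) ≥ r`. -/
def stdMP (t r : ℝ) : Set (sl2 F) :=
  {X | (r : EReal) ≤ val (X.1 0 0) ∧ ((r - t : ℝ) : EReal) ≤ val (X.1 0 1) ∧
    ((r + t : ℝ) : EReal) ≤ val (X.1 1 0)}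

/-- The parahoric subgroup at the point `t` of the standard apartment, generated by the integral
points of the diagonal torus and the affine root subgroups `U_ψ` with `ψ(t) ≥ 0`. -/
def stdParahoric (t : ℝ) : Subgroup (SL2 F) :=
  Subgroup.closure
    ({g | ∃ s : Fˣ, val (s : F) = 0 ∧ g = torusElt s} ∪
      {g | ∃ b : F, ((-t : ℝ) : EReal) ≤ val b ∧ g = upperElt b} ∪
      {g | ∃ c : F, ((t : ℝ) : EReal) ≤ val c ∧ g = lowerElt c})

/-- The action of the normalizer `N` of the diagonal torus on the standard apartment, as the
relation `s = n · t`. -/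
inductive NAct : SL2 F → ℝ → ℝ → Prop
  | torus (a : Fˣ) (t : ℝ) : NAct (torusElt a) t (t - 2 * (ord (a : F) : ℝ))
  | weyl (a : Fˣ) (t : ℝ) : NAct (weylElt a) t (-t - 2 * (ord (a : F) : ℝ))

/-- The relation defining the building: `g · t = h · s` iff there is `n ∈ N` with `s = n · t`
and `g⁻¹ h n` in the parahoric subgroup at `t`. -/
def BuildingRel (p q : SL2 F × ℝ) : Prop :=
  ∃ n : SL2 F, NAct n p.2 q.2 ∧ p.1⁻¹ * q.1 * n ∈ stdParahoric p.2

/-- The Bruhat-Tits building of `SL(2, F)`: the quotient of `SL(2, F) × ℝ` (the second factor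
being the standard apartment) by `BuildingRel`. -/
def Building (F : Type*) [Field F] [ValuativeRel F] [TopologicalSpace F]
    [IsNonarchimedeanLocalField F] : Type _ :=
  Quot (BuildingRel (F := F))

theorem ord_inv_units (s : Fˣ) : ord ((s⁻¹ : Fˣ) : F) = -ord (s : F) := by
  have h := ord_mul (F := F) (x := s) (y := ((s⁻¹ : Fˣ) : F)) s.ne_zero (s⁻¹).ne_zero
  rw [Units.mul_inv, ord_one] at h
  omega

theorem le_val_unit (s : Fˣ) : ((ord (s : F) : ℝ) : EReal) ≤ val (s : F) := by
  rw [le_val_iff]; intro _; exact le_rfl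

theorem ord_eq_zero_of_val {s : Fˣ} (h : val (s : F) = 0) : ord (s : F) = 0 := by
  simpa [val] using h

/-- Elements of `N` carry the lattice at `t` into the lattice at `n · t`. -/
theorem NAct.maps {n : SL2 F} {t s : ℝ} (h : NAct n t s) (r : ℝ) {X : sl2 F}
    (hX : X ∈ stdMP t r) : Ad n X ∈ stdMP s r := by
  obtain ⟨h1, h2, h3⟩ := hX
  cases h with
  | torus a =>
    have ha := le_val_unit a
    have hb := le_val_unit a⁻¹
    rw [ord_inv_units] at hb
    refine ⟨?_, ?_, ?_⟩ <;> rw [Ad_torusElt]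
    · simpa using h1
    · exact le_val_mul (le_val_mul ha ha le_rfl) h2 (by linarith)
    · exact le_val_mul (le_val_mul hb hb le_rfl) h3 (by push_cast; linarith)
  | weyl a =>
    have ha := le_val_unit a
    have hb := le_val_unit a⁻¹
    rw [ord_inv_units] at hb
    refine ⟨?_, ?_, ?_⟩ <;> rw [Ad_weylElt]
    · simpa [val_neg] using h1
    · change _ ≤ val (-_)
      rw [val_neg]
      exact le_val_mul (le_val_mul ha ha le_rfl) h3 (by linarith)
    · change _ ≤ val (-_)
      rw [val_neg]
      exact le_val_mul (le_val_mul hb hb le_rfl) h2 (by push_cast; linarith)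

theorem NAct.symm {n : SL2 F} {t s : ℝ} (h : NAct n t s) : NAct n⁻¹ s t := by
  cases h with
  | torus a =>
    have h1 := NAct.torus a⁻¹ (t - 2 * (ord (a : F) : ℝ))
    rw [ord_inv_units] at h1
    rw [torusElt_inv]
    convert h1 using 1
    push_cast; ring
  | weyl a =>
    have h1 := NAct.weyl (-a) (-t - 2 * (ord (a : F) : ℝ))
    rw [Units.val_neg, ord_neg] at h1
    rw [weylElt_inv]
    convert h1 using 1
    ring

/-- The parahoric subgroup at `t` preserves the Moy-Prasad lattices at `t`. -/
theorem stdParahoric_maps {t : ℝ} {k : SL2 F} (hk : k ∈ stdParahoric t) (r : ℝ) {X : sl2 F}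
    (hX : X ∈ stdMP t r) : Ad k X ∈ stdMP t r := by
  have upper : ∀ b : F, ((-t : ℝ) : EReal) ≤ val b → ∀ X : sl2 F, X ∈ stdMP t r →
      Ad (upperElt b) X ∈ stdMP t r := by
    rintro b hb X ⟨h1, h2, h3⟩
    refine ⟨?_, ?_, ?_⟩ <;> rw [Ad_upperElt]
    · exact le_val_add h1 (le_val_mul hb h3 (by linarith))
    · refine le_val_add h2 (le_val_add (le_val_add ?_ ?_) ?_)
      · rw [val_neg]; exact le_val_mul hb h1 (by linarith)
      · rw [val_neg]; exact le_val_mul hb h1 (by linarith)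
      · rw [val_neg]; exact le_val_mul (le_val_mul hb hb le_rfl) h3 (by linarith)
    · exact h3
  have lower : ∀ c : F, ((t : ℝ) : EReal) ≤ val c → ∀ X : sl2 F, X ∈ stdMP t r →
      Ad (lowerElt c) X ∈ stdMP t r := by
    rintro c hc X ⟨h1, h2, h3⟩
    refine ⟨?_, ?_, ?_⟩ <;> rw [Ad_lowerElt]
    · refine le_val_add h1 ?_
      rw [val_neg]; exact le_val_mul hc h2 (by linarith)
    · exact h2
    · refine le_val_add h3 (le_val_add (le_val_add ?_ ?_) ?_)
      · exact le_val_mul hc h1 (by linarith)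
      · exact le_val_mul hc h1 (by linarith)
      · rw [val_neg]; exact le_val_mul (le_val_mul hc hc le_rfl) h2 (by linarith)
  have torus : ∀ s : Fˣ, val (s : F) = 0 → ∀ X : sl2 F, X ∈ stdMP t r →
      Ad (torusElt s) X ∈ stdMP t r := by
    intro s hs X hX
    have h := (NAct.torus s t).maps r hX
    rwa [ord_eq_zero_of_val hs, Int.cast_zero, mul_zero, sub_zero] at h
  unfold stdParahoric at hk
  induction hk using Subgroup.closure_induction_left generalizing X with
  | one => rwa [Ad_one]
  | mul_left g hg y _ ih =>
    rw [Ad_mul]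
    rcases hg with (⟨s, hs, rfl⟩ | ⟨b, hb, rfl⟩) | ⟨c, hc, rfl⟩
    · exact torus s hs _ (ih hX)
    · exact upper b hb _ (ih hX)
    · exact lower c hc _ (ih hX)
  | inv_mul_cancel g hg y _ ih =>
    rw [Ad_mul]
    rcases hg with (⟨s, hs, rfl⟩ | ⟨b, hb, rfl⟩) | ⟨c, hc, rfl⟩
    · rw [torusElt_inv]
      refine torus _ ?_ _ (ih hX)
      have h0 := ord_inv_units s
      rw [ord_eq_zero_of_val hs] at h0
      unfold val
      rw [if_neg (s⁻¹).ne_zero, h0]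
      simp
    · have : (upperElt b)⁻¹ = upperElt (-b) := by
        apply Subtype.ext
        rw [Matrix.SpecialLinearGroup.coe_inv]
        simp [upperElt, Matrix.adjugate_fin_two]
      rw [this]
      exact upper _ (by rwa [val_neg]) _ (ih hX)
    · have : (lowerElt c)⁻¹ = lowerElt (-c) := by
        apply Subtype.ext
        rw [Matrix.SpecialLinearGroup.coe_inv]
        simp [lowerElt, Matrix.adjugate_fin_two]
      rw [this]
      exact lower _ (by rwa [val_neg]) _ (ih hX)

/-- The Moy-Prasad lattice `𝔤_{x,r}`; at the point `x = g · t` it is `Ad(g) 𝔤_{t,r}`. -/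
def MP (x : Building F) (r : ℝ) : Set (sl2 F) :=
  Quot.lift (fun p : SL2 F × ℝ => {X : sl2 F | Ad p.1⁻¹ X ∈ stdMP p.2 r})
    (by
      rintro ⟨g, t⟩ ⟨h, s⟩ ⟨n, hn, hk⟩
      dsimp only at hn hk ⊢
      have e1 : h⁻¹ = n * (g⁻¹ * h * n)⁻¹ * g⁻¹ := by group
      have e2 : g⁻¹ = (g⁻¹ * h * n) * n⁻¹ * h⁻¹ := by group
      ext X
      constructor
      · intro hX
        change Ad h⁻¹ X ∈ stdMP s r
        rw [e1, Ad_mul, Ad_mul]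
        exact hn.maps r (stdParahoric_maps (inv_mem hk) r hX)
      · intro hX
        change Ad g⁻¹ X ∈ stdMP t r
        rw [e2, Ad_mul, Ad_mul]
        exact stdParahoric_maps hk r (hn.symm.maps r hX)) x

/-- `𝔤_{x,r+}`, the union of the `𝔤_{x,s}` with `s > r`. -/
def MPplus (x : Building F) (r : ℝ) : Set (sl2 F) := {X | ∃ s : ℝ, r < s ∧ X ∈ MP x s}

/-! ## Depth, degenerate cosets and nilpotent support

The Lie algebra is identified with its dual by the trace form. -/

/-- `d_x(X) = t`: the element `X` lies in `𝔤_{x,t}` but not in `𝔤_{x,t+}`. -/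
def HasDepthAt (x : Building F) (X : sl2 F) (t : ℝ) : Prop := X ∈ MP x t ∧ X ∉ MPplus x t

/-- The depth `d(X)`, the largest `r` (`∞` for nilpotent `X`) such that `X` lies in `𝔤_{x,r}` for
some `x`. -/
noncomputable def depth (X : sl2 F) : EReal :=
  sSup {d : EReal | ∃ r : ℝ, d = (r : EReal) ∧ ∃ x : Building F, X ∈ MP x r}

/-- The nilpotent orbits that meet the coset `X + 𝔤_{x,t+}`. -/
def orbitsMeeting (x : Building F) (X : sl2 F) (t : ℝ) : Set (Set (sl2 F)) :=
  {O | O ∈ nilpotentOrbits F ∧ ∃ Y ∈ O, Y - X ∈ MPplus x t}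

/-- `O = 𝒪(X, x)`, where `t = d_x(X)`: the orbit `O` is the smallest one, for the closure
relation, among the nilpotent orbits that meet `X + 𝔤_{x,t+}`. -/
def IsMinimalOrbit (x : Building F) (X : sl2 F) (t : ℝ) (O : Set (sl2 F)) : Prop :=
  O ∈ orbitsMeeting x X t ∧ ∀ O' ∈ orbitsMeeting x X t, O ⊆ closure O'

/-- The nilpotent support of `X`: the orbits `𝒪(X, x)` for the points `x` of the building with
`d_x(X) < d(X)`. -/
def nilSupport (X : sl2 F) : Set (Set (sl2 F)) :=
  {O | ∃ (x : Building F) (t : ℝ), HasDepthAt x X t ∧ (t : EReal) < depth X ∧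
    IsMinimalOrbit x X t O}

end Building

/-! ## Norm groups -/

section Norm

/-- The subgroup `N_{E/F}(Eˣ)` of `Fˣ`. -/
noncomputable def normGroup (F E : Type*) [Field F] [Field E] [Algebra F E] : Subgroup Fˣ :=
  (Units.map (Algebra.norm F : E →* F)).range

/-- The classes of `1` and `γ` are distinct and are all the elements of `N / (Fˣ)²`. -/
def RepresentedByOneAnd {F : Type*} [Field F] (N : Subgroup Fˣ) (γ : Fˣ) : Prop :=
  ¬ IsSquare γ ∧ ∀ n : Fˣ, n ∈ N ↔ (IsSquare n ∨ IsSquare (n * γ⁻¹))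

end Norm

end SL2Support

open SL2Support

/-! A semisimple `Γ ≠ 0` has `det Γ ≠ 0`: otherwise its orbit would be a nonzero nilpotent one,
which has `0` in its closure and so is not closed. The core is `nilSupport_eq`: when `det Γ ≠ 0`,
the nilpotent support consists of the orbits `𝒪_b`, for `b` running over the nonzero upper right
entries of the conjugates of `Γ`.

Given a conjugate with upper right entry `b ≠ 0`, move far towards `-∞` in the apartment. There `b`
alone attains the depth, and the depth is below `d(Γ)`. Any nilpotent element of the degenerate
coset has upper right entry `b` plus something of larger valuation, which is `b` times a square by
Hensel's lemma, so it lies in `𝒪_b`. Conversely, `d(Γ) ≤ ord (det Γ) / 2`. If `d_x(Γ) < d(Γ)`, an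
off-diagonal entry must attain the depth, since `a² = -det - bc` prevents the diagonal from doing so
alone; a Weyl element moves a lower left entry to the upper right.

The entries `b` are the values of a binary quadratic form at nonzero vectors. In the split case this
form is hyperbolic and takes every value. For `antidiag u v` it is `u (p² - uv q²)`, so its nonzero
values form the coset `u · N(Eˣ)`, which consists of two square classes by
`exists_sq_sub_mul_sq_iff`. -/

namespace SL2Support

/-! ### Valuations and square classes in odd residual characteristic -/

section LocalField

variable {F : Type*} [Field F] [ValuativeRel F] [TopologicalSpace F]
  [IsNonarchimedeanLocalField F]

theorem ord_le_ord_iff {x y : F} (hx : x ≠ 0) (hy : y ≠ 0) :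
    ord x ≤ ord y ↔ valuation F y ≤ valuation F x := by
  unfold ord
  rw [neg_le_neg_iff, WithZero.log_le_log (by simpa using hy) (by simpa using hx)]
  exact OrderIsoClass.map_le_map_iff _

theorem ord_lt_ord_iff {x y : F} (hx : x ≠ 0) (hy : y ≠ 0) :
    ord x < ord y ↔ valuation F y < valuation F x := by
  rw [← not_le, ← not_le, ord_le_ord_iff hy hx]

theorem ord_inv {x : F} (hx : x ≠ 0) : ord x⁻¹ = -ord x := by
  simpa using ord_inv_units (Units.mk0 x hx)

theorem ord_pow {x : F} (hx : x ≠ 0) (n : ℕ) : ord (x ^ n) = n * ord x := by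
  induction n with
  | zero => simp [ord_one]
  | succ n ih => rw [pow_succ, ord_mul (pow_ne_zero _ hx) hx, ih]; push_cast; ring

theorem ord_zpow {x : F} (hx : x ≠ 0) (n : ℤ) : ord (x ^ n) = n * ord x := by
  cases n with
  | ofNat n => simpa using ord_pow hx n
  | negSucc n => rw [zpow_negSucc, ord_inv (pow_ne_zero _ hx), ord_pow hx, Int.negSucc_eq]; push_cast; ring

theorem val_of_ne_zero {x : F} (hx : x ≠ 0) : val x = ((ord x : ℝ) : EReal) := by
  simp [val, hx]

theorem ord_add_eq_left {x y : F} (hx : x ≠ 0) (h : y ≠ 0 → ord x < ord y) :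
    x + y ≠ 0 ∧ ord (x + y) = ord x := by
  by_cases hy : y = 0
  · subst hy; simpa using hx
  have hv : valuation F (x + y) = valuation F x :=
    (valuation F).map_add_eq_of_lt_left ((ord_lt_ord_iff hx hy).1 (h hy))
  refine ⟨fun h0 ↦ hx ?_, by simp only [ord, hv]⟩
  rw [h0, map_zero] at hv
  simpa using hv.symm

theorem valuation_le_one_iff {x : F} : valuation F x ≤ 1 ↔ (x ≠ 0 → 0 ≤ ord x) := by
  by_cases hx : x = 0
  · simp [hx]
  · rw [← map_one (valuation F), ← ord_le_ord_iff one_ne_zero hx, ord_one]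
    simp [hx]

theorem valuation_lt_one_iff {x : F} : valuation F x < 1 ↔ (x ≠ 0 → 0 < ord x) := by
  by_cases hx : x = 0
  · simp [hx]
  · rw [← map_one (valuation F), ← ord_lt_ord_iff one_ne_zero hx, ord_one]
    simp [hx]

theorem residue_eq_zero_iff_valuation_lt_one (x : 𝒪[F]) :
    IsLocalRing.residue 𝒪[F] x = 0 ↔ valuation F (x : F) < 1 := by
  rw [IsLocalRing.residue_eq_zero_iff, IsLocalRing.mem_maximalIdeal, mem_nonunits_iff,
    Valuation.Integers.isUnit_iff_valuation_eq_one (Valuation.integer.integers (valuation F))]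
  exact ⟨fun h ↦ lt_of_le_of_ne x.2 h, fun h ↦ h.ne⟩

theorem two_ne_zero_residueField (hp : ringChar 𝓀[F] ≠ 2) : (2 : 𝓀[F]) ≠ 0 :=
  Ring.two_ne_zero hp

theorem two_ne_zero_of_residueChar (hp : ringChar 𝓀[F] ≠ 2) : (2 : F) ≠ 0 := by
  intro h
  have h2 : (2 : 𝒪[F]) = 0 := Subtype.ext h
  apply two_ne_zero_residueField hp
  rw [← map_ofNat (IsLocalRing.residue 𝒪[F]) 2, h2, map_zero]

/-- Hensel's lemma for `X² - (1 + m)` at the approximate root `1`, where the derivative `2` is a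
unit. -/
theorem isSquare_one_add (hp : ringChar 𝓀[F] ≠ 2) {m : F} (hm : valuation F m < 1) :
    IsSquare (1 + m) := by
  let := IsTopologicalAddGroup.rightUniformSpace F
  have := isUniformAddGroup_of_addCommGroup (G := F)
  let m' : 𝒪[F] := ⟨m, hm.le⟩
  have hm' : IsLocalRing.residue 𝒪[F] m' = 0 := (residue_eq_zero_iff_valuation_lt_one m').2 hm
  have hm'' : m' ∈ 𝓂[F] := (IsLocalRing.residue_eq_zero_iff _).1 hm'
  let f : Polynomial 𝒪[F] := Polynomial.X ^ 2 - Polynomial.C (1 + m')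
  obtain ⟨a, ha, -⟩ := HenselianRing.is_henselian (I := 𝓂[F]) f
    (Polynomial.monic_X_pow_sub_C _ two_ne_zero) 1 (by simpa [f] using hm'')
    (by
      have h2 : IsUnit (IsLocalRing.residue 𝒪[F] 2) := by
        rw [map_ofNat]
        exact isUnit_iff_ne_zero.2 (two_ne_zero_residueField hp)
      have e : f.derivative.eval 1 = 2 := by simp [f, one_add_one_eq_two]
      rw [e]
      exact h2)
  have h : a ^ 2 - (1 + m') = 0 := by simpa [f, Polynomial.IsRoot] using ha
  refine ⟨(a : F), ?_⟩
  have h' := congrArg (Subtype.val) (sub_eq_zero.1 h)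
  rw [← pow_two]
  exact h'.symm

/-- A perturbation of higher valuation does not change the square class. -/
theorem exists_add_eq_mul_sq (hp : ringChar 𝓀[F] ≠ 2) {b m : F} (hb : b ≠ 0)
    (h : m ≠ 0 → ord b < ord m) : ∃ s : F, s ≠ 0 ∧ b + m = b * (s * s) := by
  have hm : valuation F (b⁻¹ * m) < 1 := by
    rw [valuation_lt_one_iff]
    intro hne
    have hm0 := right_ne_zero_of_mul hne
    rw [ord_mul (inv_ne_zero hb) hm0, ord_inv hb]
    linarith [h hm0]
  obtain ⟨s, hs⟩ := isSquare_one_add hp hm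
  have hbm : b + m = b * (s * s) := by rw [← hs]; field_simp
  refine ⟨s, ?_, hbm⟩
  rintro rfl
  exact (ord_add_eq_left hb h).1 (by simpa using hbm)

theorem exists_eq_mul_sq_of_residue_eq (hp : ringChar 𝓀[F] ≠ 2) {b c : 𝒪[F]}
    (hb : IsLocalRing.residue 𝒪[F] b ≠ 0)
    (h : IsLocalRing.residue 𝒪[F] c = IsLocalRing.residue 𝒪[F] b) :
    ∃ s : F, s ≠ 0 ∧ (c : F) = b * (s * s) := by
  rw [Ne, residue_eq_zero_iff_valuation_lt_one] at hb
  have hb1 : valuation F (b : F) = 1 := le_antisymm b.2 (not_lt.1 hb)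
  have hb0 : (b : F) ≠ 0 := by rintro h0; simp [h0] at hb1
  have hm : valuation F ((c - b : 𝒪[F]) : F) < 1 := by
    rw [← residue_eq_zero_iff_valuation_lt_one, map_sub, h, sub_self]
  obtain ⟨s, hs, hbm⟩ := exists_add_eq_mul_sq hp (m := ((c - b : 𝒪[F]) : F)) hb0
    (fun hne ↦ (ord_lt_ord_iff hb0 hne).2 (by rwa [hb1]))
  exact ⟨s, hs, by simpa using hbm⟩

theorem exists_integer_of_ord_eq_zero {x : F} (hx : x ≠ 0) (h : ord x = 0) :
    ∃ y : 𝒪[F], (y : F) = x ∧ IsLocalRing.residue 𝒪[F] y ≠ 0 := by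
  refine ⟨⟨x, valuation_le_one_iff.2 fun _ ↦ h.ge⟩, rfl, ?_⟩
  rw [Ne, residue_eq_zero_iff_valuation_lt_one, valuation_lt_one_iff]
  exact fun h' ↦ (h' hx).ne' h

/-- A unit is a square as soon as its residue is. -/
theorem isSquare_of_isSquare_residue (hp : ringChar 𝓀[F] ≠ 2) {x : 𝒪[F]}
    (hx : IsLocalRing.residue 𝒪[F] x ≠ 0) (h : IsSquare (IsLocalRing.residue 𝒪[F] x)) :
    IsSquare (x : F) := by
  obtain ⟨r, hr⟩ := h
  obtain ⟨y, rfl⟩ := IsLocalRing.residue_surjective r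
  rw [← map_mul] at hr
  obtain ⟨s, -, h⟩ := exists_eq_mul_sq_of_residue_eq hp (hr ▸ hx) hr
  exact ⟨y * s, by rw [h]; push_cast; ring⟩

theorem isSquare_mul_of_not_isSquare {k : Type*} [Field k] [Finite k]
    {a b : k} (ha : ¬ IsSquare a) (hb : ¬ IsSquare b) : IsSquare (a * b) := by
  classical
  have := Fintype.ofFinite k
  have ha0 : a ≠ 0 := by rintro rfl; simp at ha
  have hb0 : b ≠ 0 := by rintro rfl; simp at hb
  rw [← quadraticChar_one_iff_isSquare (mul_ne_zero ha0 hb0), map_mul,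
    quadraticChar_neg_one_iff_not_isSquare.2 ha, quadraticChar_neg_one_iff_not_isSquare.2 hb]
  norm_num

/-- Two nonsquare units have the same square class. -/
theorem isSquare_mul_of_ord_eq_zero (hp : ringChar 𝓀[F] ≠ 2) {x y : F} (hx : x ≠ 0) (hy : y ≠ 0)
    (hx0 : ord x = 0) (hy0 : ord y = 0) (hxs : ¬ IsSquare x) (hys : ¬ IsSquare y) :
    IsSquare (x * y) := by
  obtain ⟨x', rfl, hx'⟩ := exists_integer_of_ord_eq_zero hx hx0
  obtain ⟨y', rfl, hy'⟩ := exists_integer_of_ord_eq_zero hy hy0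
  have h := isSquare_mul_of_not_isSquare (mt (isSquare_of_isSquare_residue hp hx') hxs)
    (mt (isSquare_of_isSquare_residue hp hy') hys)
  rw [← map_mul] at h
  exact isSquare_of_isSquare_residue hp (by rw [map_mul]; exact mul_ne_zero hx' hy') h

/-- A pigeonhole count: in a finite field of odd order, the values of `p²` and of `n + d q²` each
fill more than half of the field, so they meet. -/
theorem exists_sq_sub_mul_sq {k : Type*} [Field k] [Finite k] (hk : ringChar k ≠ 2) {d : k}
    (hd : d ≠ 0) (n : k) : ∃ p q : k, p * p - d * (q * q) = n := by
  have := Fintype.ofFinite k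
  have hodd : Fintype.card k % 2 = 1 := FiniteField.odd_card_of_char_ne_two hk
  obtain ⟨p, q, h⟩ := FiniteField.exists_root_sum_quadratic (R := k)
    (f := Polynomial.X ^ 2) (g := Polynomial.C (-d) * Polynomial.X ^ 2 + Polynomial.C 0 *
      Polynomial.X + Polynomial.C (-n))
    (Polynomial.degree_X_pow 2) (Polynomial.degree_quadratic (neg_ne_zero.2 hd)) hodd
  refine ⟨p, q, ?_⟩
  simp at h
  linear_combination h

/-- The form `p² - d q²` represents all unit square classes if `d` is a unit. -/
theorem exists_sq_sub_mul_sq_eq_unit (hp : ringChar 𝓀[F] ≠ 2) {d n : F} (hd : d ≠ 0) (hn : n ≠ 0)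
    (hd0 : ord d = 0) (hn0 : ord n = 0) : ∃ p q : F, p * p - d * (q * q) = n := by
  obtain ⟨d', rfl, hd'⟩ := exists_integer_of_ord_eq_zero hd hd0
  obtain ⟨n', rfl, hn'⟩ := exists_integer_of_ord_eq_zero hn hn0
  obtain ⟨p, q, h⟩ := exists_sq_sub_mul_sq hp hd' (IsLocalRing.residue 𝒪[F] n')
  obtain ⟨p, rfl⟩ := IsLocalRing.residue_surjective p
  obtain ⟨q, rfl⟩ := IsLocalRing.residue_surjective q
  simp only [← map_mul, ← map_sub] at h
  obtain ⟨s, hs, h⟩ := exists_eq_mul_sq_of_residue_eq hp hn' h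
  refine ⟨p * s⁻¹, q * s⁻¹, ?_⟩
  push_cast at h
  field_simp
  linear_combination h

theorem even_ord_of_isSquare {x : F} (hx : x ≠ 0) (h : IsSquare x) : Even (ord x) := by
  obtain ⟨s, rfl⟩ := h
  exact ⟨ord s, ord_mul (left_ne_zero_of_mul hx) (left_ne_zero_of_mul hx)⟩

theorem exists_ord_eq_zero_mul_sq {ϖ x : F} (hϖ : ϖ ≠ 0) (hϖ1 : ord ϖ = 1) (hx : x ≠ 0)
    (h : Even (ord x)) : ∃ y s : F, y ≠ 0 ∧ s ≠ 0 ∧ ord y = 0 ∧ x = y * (s * s) := by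
  obtain ⟨k, hk⟩ := h
  have hs : ϖ ^ k ≠ 0 := zpow_ne_zero _ hϖ
  have hss := mul_ne_zero hs hs
  refine ⟨x * (ϖ ^ k * ϖ ^ k)⁻¹, ϖ ^ k, mul_ne_zero hx (inv_ne_zero hss), hs, ?_, ?_⟩
  · rw [ord_mul hx (inv_ne_zero hss), ord_inv hss, ord_mul hs hs, ord_zpow hϖ, hϖ1, hk]
    ring
  · field_simp

/-- An element of even valuation is a square or a square times a given nonsquare unit. -/
theorem exists_eq_mul_sq_of_even (hp : ringChar 𝓀[F] ≠ 2) {ε ϖ : F} (hε : ε ≠ 0)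
    (hε0 : ord ε = 0) (hεs : ¬ IsSquare ε) (hϖ : ϖ ≠ 0) (hϖ1 : ord ϖ = 1) {x : F} (hx : x ≠ 0)
    (h : Even (ord x)) : ∃ s : F, s ≠ 0 ∧ (x = 1 * (s * s) ∨ x = ε * (s * s)) := by
  obtain ⟨y, s, hy, hs, hy0, rfl⟩ := exists_ord_eq_zero_mul_sq hϖ hϖ1 hx h
  by_cases hys : IsSquare y
  · obtain ⟨r, rfl⟩ := hys
    exact ⟨r * s, mul_ne_zero (left_ne_zero_of_mul hy) hs, .inl (by ring)⟩
  · obtain ⟨r, hr⟩ := isSquare_mul_of_ord_eq_zero hp hε hy hε0 hy0 hεs hys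
    have hr0 : r ≠ 0 := by rintro rfl; exact mul_ne_zero hε hy (by simpa using hr)
    refine ⟨r * s * ε⁻¹, by simp [*], .inr ?_⟩
    field_simp
    linear_combination hr

/-- The four square classes of a local field of odd residual characteristic. -/
theorem exists_eq_mul_sq (hp : ringChar 𝓀[F] ≠ 2) {ε ϖ : F} (hε : ε ≠ 0)
    (hε0 : ord ε = 0) (hεs : ¬ IsSquare ε) (hϖ : ϖ ≠ 0) (hϖ1 : ord ϖ = 1) {x : F} (hx : x ≠ 0) :
    ∃ s : F, s ≠ 0 ∧
      (x = 1 * (s * s) ∨ x = ε * (s * s) ∨ x = ϖ * (s * s) ∨ x = ε * ϖ * (s * s)) := by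
  rcases Int.even_or_odd (ord x) with h | h
  · obtain ⟨s, hs, h | h⟩ := exists_eq_mul_sq_of_even hp hε hε0 hεs hϖ hϖ1 hx h
    · exact ⟨s, hs, .inl h⟩
    · exact ⟨s, hs, .inr (.inl h)⟩
  · have hx' : x * ϖ⁻¹ ≠ 0 := mul_ne_zero hx (inv_ne_zero hϖ)
    have he : Even (ord (x * ϖ⁻¹)) := by
      rw [ord_mul hx (inv_ne_zero hϖ), ord_inv hϖ, hϖ1]
      exact h.add_odd (by decide)
    obtain ⟨s, hs, h | h⟩ := exists_eq_mul_sq_of_even hp hε hε0 hεs hϖ hϖ1 hx' he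
    · exact ⟨s, hs, .inr (.inr (.inl (by field_simp at h; linear_combination h)))⟩
    · exact ⟨s, hs, .inr (.inr (.inr (by field_simp at h; linear_combination h)))⟩

theorem tendsto_pow_of_ord_pos {x : F} (hx : x ≠ 0 → 0 < ord x) :
    Filter.Tendsto (fun n : ℕ ↦ x ^ n) Filter.atTop (nhds 0) := by
  let := IsTopologicalAddGroup.rightUniformSpace F
  have := isUniformAddGroup_of_addCommGroup (G := F)
  rw [(IsValuativeTopology.hasBasis_nhds_zero' F).tendsto_right_iff]
  intro γ hγ
  obtain ⟨y, rfl⟩ := ValuativeRel.valuation_surjective γ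
  have hy : y ≠ 0 := by simpa using hγ
  -- The `+ 1` gives `n > ord y`, and it also excludes `n = 0`, where `0 ^ n` would be `1`.
  filter_upwards [Filter.eventually_ge_atTop ((ord y).toNat + 1)] with n hn
  by_cases hx0 : x = 0
  · have : n ≠ 0 := by omega
    simp [hx0, this, zero_lt_iff, hy]
  · rw [← ord_lt_ord_iff hy (pow_ne_zero _ hx0), ord_pow hx0]
    have h1 := hx hx0
    have h2 : ord y < n := by omega
    nlinarith

end LocalField

/-! ### Orbits, invariants and upper right entries over a field -/

section Orbit

variable {K : Type*} [Field K]

theorem mem_adOrbit_self (X : sl2 K) : X ∈ adOrbit X := ⟨1, Ad_one X⟩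

theorem Ad_inv_Ad (g : SL2 K) (X : sl2 K) : Ad g⁻¹ (Ad g X) = X := by
  rw [← Ad_mul, inv_mul_cancel, Ad_one]

theorem Ad_sub (g : SL2 K) (X Y : sl2 K) : Ad g (X - Y) = Ad g X - Ad g Y :=
  Subtype.ext (by simp [Ad, mul_sub, sub_mul])

theorem Ad_mem_adOrbit_iff (g : SL2 K) {X Y : sl2 K} : Ad g X ∈ adOrbit Y ↔ X ∈ adOrbit Y := by
  constructor
  · rintro ⟨h, hh⟩
    refine ⟨g⁻¹ * h, ?_⟩
    simp only at hh ⊢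
    rw [Ad_mul, hh, Ad_inv_Ad]
  · rintro ⟨h, rfl⟩
    exact ⟨g * h, Ad_mul _ _ _⟩

theorem adOrbit_eq_of_mem {X Y : sl2 K} (h : X ∈ adOrbit Y) : adOrbit X = adOrbit Y := by
  obtain ⟨g, rfl⟩ := h
  ext Z
  constructor
  · rintro ⟨h, rfl⟩
    exact (Ad_mem_adOrbit_iff h).2 ((Ad_mem_adOrbit_iff g).2 (mem_adOrbit_self Y))
  · rintro ⟨h, rfl⟩
    exact ⟨h * g⁻¹, by simp only [Ad_mul, Ad_inv_Ad]⟩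

theorem mem_adOrbit_symm {X Y : sl2 K} (h : X ∈ adOrbit Y) : Y ∈ adOrbit X := by
  rw [adOrbit_eq_of_mem h]; exact mem_adOrbit_self Y

theorem det_Ad (g : SL2 K) (X : sl2 K) : (Ad g X).1.det = X.1.det := by
  simp only [Ad, Matrix.det_mul, Matrix.SpecialLinearGroup.det_coe, one_mul, mul_one]

theorem det_eq_of_mem_adOrbit {X Y : sl2 K} (h : X ∈ adOrbit Y) : X.1.det = Y.1.det := by
  obtain ⟨g, rfl⟩ := h
  exact det_Ad g Y

theorem det_eq (X : sl2 K) : X.1.det = -(X.1 0 0 * X.1 0 0) - X.1 0 1 * X.1 1 0 := by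
  rw [Matrix.det_fin_two, sl2_apply_one_one]; ring

theorem sl2_ext {X Y : sl2 K} (h1 : X.1 0 0 = Y.1 0 0) (h2 : X.1 0 1 = Y.1 0 1)
    (h3 : X.1 1 0 = Y.1 1 0) : X = Y := by
  apply Subtype.ext
  ext i j
  fin_cases i <;> fin_cases j
  · exact h1
  · exact h2
  · exact h3
  · simpa [sl2_apply_one_one] using h1

@[simp] theorem tmat_zero_zero (a b c : K) : (tmat a b c).1 0 0 = a := rfl
@[simp] theorem tmat_zero_one (a b c : K) : (tmat a b c).1 0 1 = b := rfl
@[simp] theorem tmat_one_zero (a b c : K) : (tmat a b c).1 1 0 = c := rfl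

/-- An element with nonzero upper right entry is conjugate to an antidiagonal one. -/
theorem antidiag_mem_adOrbit {X : sl2 K} (hb : X.1 0 1 ≠ 0) :
    antidiag (X.1 0 1) (-X.1.det / X.1 0 1) ∈ adOrbit X := by
  refine ⟨lowerElt (X.1 0 0 / X.1 0 1), sl2_ext ?_ ?_ ?_⟩ <;> simp only [Ad_lowerElt, antidiag]
  · simp [hb]
  · simp
  · rw [det_eq]; simp; field_simp; ring

/-- When the determinant vanishes, so does the lower left entry of the antidiagonal representative.
-/
theorem adOrbit_eq_orbitO {X : sl2 K} (hX : X.1.det = 0) (hb : X.1 0 1 ≠ 0) :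
    adOrbit X = orbitO (X.1 0 1) := by
  have h := antidiag_mem_adOrbit hb
  rw [hX, neg_zero, zero_div] at h
  exact (adOrbit_eq_of_mem h).symm

theorem orbitO_mul_sq (u : K) {s : K} (hs : s ≠ 0) : orbitO (u * (s * s)) = orbitO u := by
  refine adOrbit_eq_of_mem ⟨torusElt (Units.mk0 s hs), sl2_ext ?_ ?_ ?_⟩ <;>
    simp only [Ad_torusElt] <;> simp
  ring

/-- Lets statements about upper right entries be applied to lower left ones. -/
theorem exists_mem_adOrbit_neg_lower (X : sl2 K) :
    ∃ Y ∈ adOrbit X, Y.1 0 0 = -X.1 0 0 ∧ Y.1 0 1 = -X.1 1 0 ∧ Y.1 1 0 = -X.1 0 1 :=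
  ⟨_, ⟨weylElt 1, rfl⟩, by simp only [Ad_weylElt]; simp⟩

theorem Ad_apply_zero_one (g : SL2 K) (X : sl2 K) :
    (Ad g X).1 0 1 = g.1 0 0 * g.1 0 0 * X.1 0 1 - 2 * (g.1 0 0 * g.1 0 1 * X.1 0 0)
      - g.1 0 1 * g.1 0 1 * X.1 1 0 := by
  have h := sl2_apply_one_one X
  rw [Ad_val]
  simp [Matrix.mul_apply, Fin.sum_univ_two, h]
  ring

/-- The upper right entries of the elements of an orbit are the values of a binary quadratic
form at nonzero vectors. -/
theorem exists_mem_adOrbit_zero_one_eq_iff (X : sl2 K) (b : K) :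
    (∃ Y ∈ adOrbit X, Y.1 0 1 = b) ↔ ∃ p q : K, (p ≠ 0 ∨ q ≠ 0) ∧
      b = p * p * X.1 0 1 - 2 * (p * q * X.1 0 0) - q * q * X.1 1 0 := by
  constructor
  · rintro ⟨_, ⟨g, rfl⟩, rfl⟩
    refine ⟨g.1 0 0, g.1 0 1, ?_, Ad_apply_zero_one g X⟩
    by_contra! h
    have := g.2
    rw [Matrix.det_fin_two] at this
    simp [h.1, h.2] at this
  · rintro ⟨p, q, hpq, rfl⟩
    -- A nonzero vector extends to the first row of a matrix of determinant one.
    have : ∃ g : SL2 K, g.1 0 0 = p ∧ g.1 0 1 = q := by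
      by_cases hp : p = 0
      · have hq : q ≠ 0 := by simpa [hp] using hpq
        exact ⟨⟨!![p, q; -q⁻¹, 0], by simp [Matrix.det_fin_two, hq]⟩, rfl, rfl⟩
      · exact ⟨⟨!![p, q; 0, p⁻¹], by simp [Matrix.det_fin_two, hp]⟩, rfl, rfl⟩
    obtain ⟨g, rfl, rfl⟩ := this
    exact ⟨_, ⟨g, rfl⟩, Ad_apply_zero_one g X⟩

theorem det_tmat (a b c : K) : (tmat a b c).1.det = -(a * a) - b * c := by
  rw [det_eq]; simp

theorem tmat_self (X : sl2 K) : tmat (X.1 0 0) (X.1 0 1) (X.1 1 0) = X := sl2_ext rfl rfl rfl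

/-- The image of `X` in `sl(2, E)`. -/
def mapSl2 (E : Type*) [Field E] [Algebra K E] (X : sl2 K) : sl2 E :=
  tmat (algebraMap K E (X.1 0 0)) (algebraMap K E (X.1 0 1)) (algebraMap K E (X.1 1 0))

theorem mapSl2_val (E : Type*) [Field E] [Algebra K E] (X : sl2 K) :
    (mapSl2 E X).1 = X.1.map (algebraMap K E) := by
  ext i j
  fin_cases i <;> fin_cases j <;> simp [mapSl2, tmat, sl2_apply_one_one]

theorem splitsOver_iff (E : Type*) [Field E] [Algebra K E] (X : sl2 K) :
    SplitsOver E X ↔ ∃ a : E, mapSl2 E X ∈ adOrbit (tmat a 0 0) := by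
  simp only [SplitsOver, ← mapSl2_val, adOrbit, Set.mem_range]
  rw [exists_comm]
  refine exists_congr fun a ↦ exists_congr fun g ↦ ?_
  rw [← Subtype.ext_iff, eq_comm]

theorem mapSl2_self (X : sl2 K) : mapSl2 K X = X := tmat_self X

theorem mapSl2_Ad (E : Type*) [Field E] [Algebra K E] (g : SL2 K) (X : sl2 K) :
    mapSl2 E (Ad g X) ∈ adOrbit (mapSl2 E X) := by
  refine ⟨Matrix.SpecialLinearGroup.map (algebraMap K E) g, Subtype.ext ?_⟩
  simp only [mapSl2_val, Ad, Matrix.map_mul, ← map_inv]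
  rfl

theorem SplitsOver.of_mem_adOrbit {E : Type*} [Field E] [Algebra K E] {X Y : sl2 K}
    (h : SplitsOver E Y) (hX : X ∈ adOrbit Y) : SplitsOver E X := by
  rw [splitsOver_iff] at h ⊢
  obtain ⟨a, ha⟩ := h
  obtain ⟨g, rfl⟩ := hX
  exact ⟨a, adOrbit_eq_of_mem ha ▸ mapSl2_Ad E g Y⟩

theorem antidiag_mem_adOrbit_of_sq (h2 : (2 : K) ≠ 0) {u v s : K} (hu : u ≠ 0) (hs : s ≠ 0)
    (h : s * s = u * v) : antidiag u v ∈ adOrbit (tmat s 0 0) := by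
  have hv : v = s * s / u := by field_simp; linear_combination -h
  -- The columns are eigenvectors of `antidiag u v` for `s` and `-s`, scaled to make the determinant
  -- one.
  obtain ⟨g, h00, h01, h10, h11⟩ : ∃ g : SL2 K, g.1 0 0 = u ∧ g.1 0 1 = -1 / (2 * s) ∧
      g.1 1 0 = s ∧ g.1 1 1 = 1 / (2 * u) := by
    refine ⟨⟨!![u, -1 / (2 * s); s, 1 / (2 * u)], ?_⟩, rfl, rfl, rfl, rfl⟩
    rw [Matrix.det_fin_two]; simp; field_simp; norm_num
  refine ⟨g, sl2_ext ?_ ?_ ?_⟩ <;> simp only [Ad_val] <;>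
    simp [Matrix.mul_apply, Fin.sum_univ_two, antidiag, sl2_apply_one_one, h00, h01, h10, h11, hv]
  all_goals field_simp
  all_goals ring

theorem splitsOver_antidiag {E : Type*} [Field E] [Algebra K E] (h2 : (2 : K) ≠ 0) {u v : K}
    (hu : u ≠ 0) (hv : v ≠ 0) {s : E} (hs : s ^ 2 = algebraMap K E (u * v)) :
    SplitsOver E (antidiag u v) := by
  rw [splitsOver_iff]
  have h2' : (2 : E) ≠ 0 := by
    rw [← map_ofNat (algebraMap K E) 2]; simpa using h2
  have hu' : algebraMap K E u ≠ 0 := by simpa using hu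
  have hs0 : s ≠ 0 := by
    rintro rfl
    have := hs.symm
    simp [hu, hv] at this
  refine ⟨s, ?_⟩
  have h := antidiag_mem_adOrbit_of_sq h2' (v := algebraMap K E v) hu' hs0
    (by rw [← pow_two, hs, map_mul])
  simpa [mapSl2, antidiag] using h

/-- A nonsplit regular element is conjugate to an antidiagonal one. -/
theorem exists_antidiag_mem_adOrbit {X : sl2 K} (h2 : (2 : K) ≠ 0) (hX : X.1.det ≠ 0)
    (hs : ¬ SplitsOver K X) : ∃ u v : Kˣ, antidiag (u : K) (v : K) ∈ adOrbit X := by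
  have hb : X.1 0 1 ≠ 0 := by
    intro hb
    -- A lower triangular element with distinct eigenvalues `±a` is diagonalized by a lower
    -- unipotent, so it would split.
    refine hs ((splitsOver_iff _ _).2 ⟨X.1 0 0, ?_⟩)
    rw [mapSl2_self]
    have ha : X.1 0 0 ≠ 0 := by
      intro ha
      rw [det_eq, ha, hb] at hX
      simp at hX
    refine mem_adOrbit_symm ⟨lowerElt (-X.1 1 0 / (2 * X.1 0 0)), sl2_ext ?_ ?_ ?_⟩ <;>
      simp only [Ad_lowerElt] <;> simp [hb]
    field_simp
    ring
  exact ⟨Units.mk0 _ hb, Units.mk0 (-X.1.det / X.1 0 1) (by simp [hX, hb]),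
    antidiag_mem_adOrbit hb⟩

end Orbit

/-! ### Nilpotent orbits, depth and the nilpotent support -/

section Support

variable {F : Type*} [Field F] [ValuativeRel F] [TopologicalSpace F]
  [IsNonarchimedeanLocalField F]

/-- Conjugating by `diag(ϖⁿ, ϖ⁻ⁿ)` scales the entry by `ϖ²ⁿ`, which tends to `0`. -/
theorem isNilpotentElt_tmat {ϖ : F} (hϖ : ϖ ≠ 0) (hϖ1 : ord ϖ = 1) (u : F) :
    IsNilpotentElt (tmat 0 u 0) := by
  have h : Filter.Tendsto (fun n : ℕ ↦ tmat 0 (ϖ ^ n * ϖ ^ n * u) 0) Filter.atTop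
      (nhds (0 : sl2 F)) := by
    refine tendsto_subtype_rng.2 (tendsto_pi_nhds.2 fun i ↦ tendsto_pi_nhds.2 fun j ↦ ?_)
    have h1 := tendsto_pow_of_ord_pos (x := ϖ) (fun _ ↦ by omega)
    have h2 := (h1.mul h1).mul_const u
    rw [mul_zero, zero_mul] at h2
    fin_cases i <;> fin_cases j
    · exact tendsto_const_nhds
    · exact h2
    · exact tendsto_const_nhds
    · simpa [tmat] using tendsto_const_nhds
  refine mem_closure_of_tendsto h (Filter.Eventually.of_forall fun n ↦ ?_)
  refine ⟨torusElt (Units.mk0 (ϖ ^ n) (pow_ne_zero _ hϖ)), sl2_ext ?_ ?_ ?_⟩ <;>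
    simp only [Ad_torusElt] <;> simp

theorem continuous_det_sl2 : Continuous fun X : sl2 F ↦ X.1.det :=
  continuous_subtype_val.matrix_det

/-- The determinant is continuous and constant on the orbit, hence constant on its closure. -/
theorem IsNilpotentElt.det_eq_zero {X : sl2 F} (h : IsNilpotentElt X) : X.1.det = 0 := by
  let := IsTopologicalAddGroup.rightUniformSpace F
  have := isUniformAddGroup_of_addCommGroup (G := F)
  have hc : IsClosed {Y : sl2 F | Y.1.det = X.1.det} :=
    isClosed_eq continuous_det_sl2 continuous_const
  have h0 : (0 : sl2 F).1.det = X.1.det :=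
    closure_minimal (fun Y hY ↦ det_eq_of_mem_adOrbit hY) hc h
  simpa using h0.symm

theorem det_ne_zero_of_isSemisimpleElt {ϖ : F} (hϖ : ϖ ≠ 0) (hϖ1 : ord ϖ = 1) {X : sl2 F}
    (hX : X ≠ 0) (hs : IsSemisimpleElt X) : X.1.det ≠ 0 := by
  intro hd
  -- A nonzero upper right entry would make the orbit some `𝒪_b`; being closed, it would contain
  -- `0`, forcing `X = 0`.
  have key : ∀ Y ∈ adOrbit X, Y.1 0 1 = 0 := by
    intro Y hY
    by_contra hb
    have h := adOrbit_eq_orbitO (X := Y) (by rw [det_eq_of_mem_adOrbit hY, hd]) hb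
    rw [adOrbit_eq_of_mem hY] at h
    have h0 : (0 : sl2 F) ∈ adOrbit X := by
      rw [← hs.closure_eq, h]
      exact isNilpotentElt_tmat hϖ hϖ1 _
    obtain ⟨g, hg⟩ := h0
    apply hX
    rw [← Ad_inv_Ad g X]
    simp only at hg
    rw [hg]
    exact Subtype.ext (by simp [Ad])
  have hb := key X (mem_adOrbit_self X)
  have ha : X.1 0 0 = 0 := by
    rw [det_eq, hb] at hd
    simpa using hd
  obtain ⟨Y, hY, -, hY1, -⟩ := exists_mem_adOrbit_neg_lower X
  have hc : X.1 1 0 = 0 := by simpa [hY1] using key Y hY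
  exact hX (sl2_ext ha hb hc)

/-- In `𝔤_{t,r}` the shifts by `-t` and `t` cancel in `bc`, so both terms of the determinant have
valuation at least `2r`. -/
theorem depth_le {X : sl2 F} (hX : X.1.det ≠ 0) :
    depth X ≤ ((ord X.1.det / 2 : ℝ) : EReal) := by
  refine sSup_le ?_
  rintro _ ⟨r, rfl, x, hx⟩
  obtain ⟨⟨g, t⟩, rfl⟩ := Quot.exists_rep x
  obtain ⟨h1, h2, h3⟩ : Ad g⁻¹ X ∈ stdMP t r := hx
  have hdet : (Ad g⁻¹ X).1.det = X.1.det := det_Ad _ _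
  have h : ((2 * r : ℝ) : EReal) ≤ val X.1.det := by
    rw [← hdet, det_eq, sub_eq_add_neg]
    refine le_val_add ?_ ?_ <;> rw [val_neg]
    · exact le_val_mul h1 h1 (by linarith)
    · exact le_val_mul h2 h3 (by linarith)
  rw [le_val_iff] at h
  rw [EReal.coe_le_coe_iff]
  linarith [h hX]

theorem exists_mem_stdMP (X : sl2 F) : ∃ r : ℝ, X ∈ stdMP 0 r := by
  have h (x : F) : (((ord x : ℝ)) : EReal) ≤ val x := by
    rw [le_val_iff]; exact fun _ ↦ le_rfl
  refine ⟨min (ord (X.1 0 0)) (min (ord (X.1 0 1)) (ord (X.1 1 0))), ?_, ?_, ?_⟩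
  · exact le_trans (EReal.coe_le_coe_iff.2 (min_le_left _ _)) (h _)
  · rw [sub_zero]
    exact le_trans (EReal.coe_le_coe_iff.2 ((min_le_right _ _).trans (min_le_left _ _))) (h _)
  · rw [add_zero]
    exact le_trans (EReal.coe_le_coe_iff.2 ((min_le_right _ _).trans (min_le_right _ _))) (h _)

theorem exists_coe_le_depth (X : sl2 F) : ∃ r : ℝ, (r : EReal) ≤ depth X := by
  obtain ⟨r, hr⟩ := exists_mem_stdMP X
  refine ⟨r, le_sSup ⟨r, rfl, Quot.mk _ (1, 0), ?_⟩⟩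
  change Ad 1⁻¹ X ∈ stdMP 0 r
  rwa [inv_one, Ad_one]

/-- The coset alters the upper right entry only by terms of larger valuation, so its square class,
and with it the nilpotent orbit, is fixed. -/
theorem adOrbit_eq_orbitO_of_sub_mem_stdMP (hp : ringChar 𝓀[F] ≠ 2) {X Y : sl2 F} {t s : ℝ}
    (hY : Y.1.det = 0) (hYX : Y - X ∈ stdMP t s) (hb : X.1 0 1 ≠ 0) (hs : ord (X.1 0 1) + t < s) :
    adOrbit Y = orbitO (X.1 0 1) := by
  obtain ⟨-, h, -⟩ := hYX
  have hm : Y.1 0 1 = X.1 0 1 + (Y - X).1 0 1 := by simp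
  obtain ⟨q, hq, h⟩ := exists_add_eq_mul_sq hp (m := (Y - X).1 0 1) hb (fun hne ↦ by
    have h1 := (le_val_iff _ _).1 h hne
    have h2 : (ord (X.1 0 1) : ℝ) < ord ((Y - X).1 0 1) := by linarith
    exact_mod_cast h2)
  rw [← hm] at h
  rw [adOrbit_eq_orbitO hY (by rw [h]; simp [hb, hq]), h, orbitO_mul_sq _ hq]

/-- `𝒪_b` lies in the nilpotent support if `b` is an upper right entry in the orbit. -/
theorem orbitO_mem_nilSupport (hp : ringChar 𝓀[F] ≠ 2) {ϖ : F} (hϖ : ϖ ≠ 0) (hϖ1 : ord ϖ = 1)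
    {Γ X : sl2 F} (hX : X ∈ adOrbit Γ) (hb : X.1 0 1 ≠ 0) :
    orbitO (X.1 0 1) ∈ nilSupport Γ := by
  obtain ⟨g, rfl⟩ := mem_adOrbit_symm hX
  obtain ⟨r, hr⟩ := exists_coe_le_depth (Ad g X)
  obtain ⟨r', h1, -, h3⟩ := exists_mem_stdMP X
  rw [add_zero] at h3
  -- For `t` sufficiently negative, `ord b + t` lies below the depth of `Γ` and below the levels of
  -- the diagonal and lower left entries.
  obtain ⟨t, ht1, ht2, ht3⟩ : ∃ t : ℝ, ord (X.1 0 1) + t < r ∧ ord (X.1 0 1) + t < r' ∧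
      ord (X.1 0 1) + t < r' - t := by
    obtain ⟨t, ⟨h1, h2⟩, h3⟩ := (((Filter.eventually_lt_atBot (r - ord (X.1 0 1))).and
      (Filter.eventually_lt_atBot (r' - ord (X.1 0 1)))).and
      (Filter.eventually_lt_atBot ((r' - ord (X.1 0 1)) / 2))).exists
    exact ⟨t, by linarith, by linarith, by linarith⟩
  have mono {p q : ℝ} {x : F} (hx : (q : EReal) ≤ val x) (hpq : p ≤ q) : (p : EReal) ≤ val x :=
    (EReal.coe_le_coe_iff.2 hpq).trans hx
  refine ⟨Quot.mk _ (g, t), ord (X.1 0 1) + t, ⟨?_, ?_⟩,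
    lt_of_lt_of_le (EReal.coe_lt_coe_iff.2 ht1) hr, ⟨?_, ?_⟩, ?_⟩
  · change Ad g⁻¹ (Ad g X) ∈ stdMP t _
    rw [Ad_inv_Ad]
    refine ⟨mono h1 ht2.le, ?_, mono h3 (by linarith)⟩
    rw [add_sub_cancel_right, val_of_ne_zero hb]
  · rintro ⟨s, hs, h⟩
    change Ad g⁻¹ (Ad g X) ∈ stdMP t _ at h
    rw [Ad_inv_Ad] at h
    have := (le_val_iff _ _).1 h.2.1 hb
    linarith
  · exact ⟨_, isNilpotentElt_tmat hϖ hϖ1 _, rfl⟩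
  · refine ⟨Ad g (tmat 0 (X.1 0 1) 0), ⟨g, rfl⟩, min r' (r' - t), lt_min ht2 ht3, ?_⟩
    change Ad g⁻¹ (Ad g _ - Ad g X) ∈ stdMP t _
    rw [Ad_sub, Ad_inv_Ad, Ad_inv_Ad]
    refine ⟨?_, ?_, ?_⟩
    · simpa [val_neg] using mono h1 (min_le_left r' (r' - t))
    · simp [val]
    · simpa [val_neg] using mono h3 (by linarith [min_le_right r' (r' - t)] :
        min r' (r' - t) + t ≤ r')
  -- Every nilpotent orbit meeting the coset equals `𝒪_b`, so minimality is automatic.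
  · rintro _ ⟨⟨Z, hZ, rfl⟩, Y, hY, s, hs, h⟩
    change Ad g⁻¹ (Y - Ad g X) ∈ stdMP t s at h
    rw [Ad_sub, Ad_inv_Ad] at h
    have hY0 : (Ad g⁻¹ Y).1.det = 0 := by
      rw [det_Ad, det_eq_of_mem_adOrbit hY, hZ.det_eq_zero]
    rw [← adOrbit_eq_orbitO_of_sub_mem_stdMP hp hY0 h hb hs, adOrbit_eq_of_mem ⟨g⁻¹, rfl⟩,
      adOrbit_eq_of_mem hY]
    exact subset_closure

/-- Transport `Γ` to the standard apartment. One off-diagonal entry must lie outside the deeper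
lattice containing the difference `Y - Γ`, and that entry determines the orbit of `Y`. -/
theorem exists_mem_adOrbit_of_mem_nilSupport (hp : ringChar 𝓀[F] ≠ 2) {Γ : sl2 F}
    (hΓ : Γ.1.det ≠ 0) {O : Set (sl2 F)} (hO : O ∈ nilSupport Γ) :
    ∃ X ∈ adOrbit Γ, X.1 0 1 ≠ 0 ∧ O = orbitO (X.1 0 1) := by
  obtain ⟨x, r, ⟨hr, hr'⟩, hd, ⟨⟨Z, hZ, rfl⟩, Y, hY, s, hs, h⟩, -⟩ := hO
  obtain ⟨⟨g, t⟩, rfl⟩ := Quot.exists_rep x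
  change Ad g⁻¹ Γ ∈ stdMP t r at hr
  change Ad g⁻¹ (Y - Γ) ∈ stdMP t s at h
  rw [Ad_sub] at h
  have hd : r < ord Γ.1.det / 2 := EReal.coe_lt_coe_iff.1 (hd.trans_le (depth_le hΓ))
  have hY0 : Y.1.det = 0 := by rw [det_eq_of_mem_adOrbit hY, hZ.det_eq_zero]
  rw [← adOrbit_eq_of_mem hY]
  have hX : Ad g⁻¹ Γ ∈ adOrbit Γ := ⟨_, rfl⟩
  have hXd : (Ad g⁻¹ Γ).1.det = Γ.1.det := det_Ad _ _
  have hYo : adOrbit (Ad g⁻¹ Y) = adOrbit Y := adOrbit_eq_of_mem ⟨_, rfl⟩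
  have hY0' : (Ad g⁻¹ Y).1.det = 0 := by rw [det_Ad, hY0]
  have hr'' : ∀ s', r < s' → Ad g⁻¹ Γ ∉ stdMP t s' := fun s' h1 h2 ↦ hr' ⟨s', h1, h2⟩
  rw [← hYo]
  generalize Ad g⁻¹ Γ = X at *
  generalize Ad g⁻¹ Y = Y' at *
  by_cases hb : ((s - t : ℝ) : EReal) ≤ val (X.1 0 1)
  · by_cases hc : ((s + t : ℝ) : EReal) ≤ val (X.1 1 0)
    · exfalso
      have mono {p q : ℝ} {x : F} (hx : (q : EReal) ≤ val x) (hpq : p ≤ q) :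
        (p : EReal) ≤ val x := (EReal.coe_le_coe_iff.2 hpq).trans hx
      -- If both off-diagonal entries are deep, `a² = -det - bc` puts the whole matrix at level `m >
      -- r`, contradicting the depth. The cap `ord det / 2` is what the determinant term allows.
      set m : ℝ := min s (ord Γ.1.det / 2)
      have hm1 : m ≤ s := min_le_left _ _
      have hm2 : m ≤ ord Γ.1.det / 2 := min_le_right _ _
      refine hr'' m (lt_min hs hd) ⟨?_, mono hb (by linarith), mono hc (by linarith)⟩
      have ha2 : ((2 * m : ℝ) : EReal) ≤ val (X.1 0 0 * X.1 0 0) := by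
        have e : X.1 0 0 * X.1 0 0 = -Γ.1.det + -(X.1 0 1 * X.1 1 0) := by
          rw [← hXd, det_eq]; ring
        rw [e]
        refine le_val_add ?_ ?_ <;> rw [val_neg]
        · rw [le_val_iff]; intro _; linarith
        · exact le_val_mul hb hc (by linarith)
      rw [le_val_iff] at ha2 ⊢
      intro ha
      have := ha2 (mul_ne_zero ha ha)
      rw [ord_mul ha ha] at this
      push_cast at this
      linarith
    · rw [le_val_iff] at hc
      push Not at hc
      obtain ⟨hc0, hc⟩ := hc
      have h1 (Z : sl2 F) : (Ad (weylElt 1) Z).1 0 1 = -Z.1 1 0 := by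
        rw [Ad_weylElt]; simp
      -- The Weyl element swaps the off-diagonal entries up to sign and reflects the apartment,
      -- sending `t` to `-t`.
      have hmaps : Ad (weylElt 1) (Y' - X) ∈ stdMP (-t) s := by
        simpa [ord_one] using (NAct.weyl 1 t).maps s h
      rw [Ad_sub] at hmaps
      have hb' : (Ad (weylElt 1) X).1 0 1 ≠ 0 := by rw [h1]; simpa using hc0
      refine ⟨Ad (weylElt 1) X, (Ad_mem_adOrbit_iff _).2 hX, hb', ?_⟩
      rw [← adOrbit_eq_orbitO_of_sub_mem_stdMP hp (by rw [det_Ad, hY0']) hmaps hb'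
        (by rw [h1, ord_neg]; linarith), adOrbit_eq_of_mem ⟨_, rfl⟩]
  · rw [le_val_iff] at hb
    push Not at hb
    obtain ⟨hb0, hb⟩ := hb
    exact ⟨X, hX, hb0, adOrbit_eq_orbitO_of_sub_mem_stdMP hp hY0' h hb0 (by linarith)⟩

/-- The nilpotent support consists of the orbits `𝒪_b` for the nonzero upper right entries `b` of
the elements of the orbit. -/
theorem nilSupport_eq (hp : ringChar 𝓀[F] ≠ 2) {ϖ : F} (hϖ : ϖ ≠ 0) (hϖ1 : ord ϖ = 1)
    {Γ : sl2 F} (hΓ : Γ.1.det ≠ 0) :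
    nilSupport Γ = {O | ∃ b : F, b ≠ 0 ∧ (∃ X ∈ adOrbit Γ, X.1 0 1 = b) ∧ O = orbitO b} := by
  ext O
  constructor
  · intro hO
    obtain ⟨X, hX, hb, rfl⟩ := exists_mem_adOrbit_of_mem_nilSupport hp hΓ hO
    exact ⟨_, hb, ⟨X, hX, rfl⟩, rfl⟩
  · rintro ⟨_, hb, ⟨X, hX, rfl⟩, rfl⟩
    exact orbitO_mem_nilSupport hp hϖ hϖ1 hX hb

end Support

/-! ### The norm form of a quadratic extension -/

section QuadraticNorm

variable {K E : Type*} [Field K] [Field E] [Algebra K E]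

theorem exists_eq_add_mul_of_adjoin_eq_top {d : K} {s : E} (hs : s ^ 2 = algebraMap K E d)
    (hE : IntermediateField.adjoin K {s} = ⊤) (x : E) :
    ∃ p q : K, x = algebraMap K E p + algebraMap K E q * s := by
  have hint : IsIntegral K s := by
    refine ⟨Polynomial.X ^ 2 - Polynomial.C d, Polynomial.monic_X_pow_sub_C _ two_ne_zero, ?_⟩
    simp [hs]
  have hx : x ∈ Algebra.adjoin K {s} := by
    rw [← IntermediateField.adjoin_simple_toSubalgebra_of_isAlgebraic hint.isAlgebraic, hE]
    exact IntermediateField.mem_top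
  induction hx using Algebra.adjoin_induction with
  | mem x hx => exact ⟨0, 1, by simpa using hx⟩
  | algebraMap r => exact ⟨r, 0, by simp⟩
  | add x y _ _ hx hy =>
    obtain ⟨p, q, rfl⟩ := hx
    obtain ⟨p', q', rfl⟩ := hy
    exact ⟨p + p', q + q', by simp only [map_add]; ring⟩
  | mul x y _ _ hx hy =>
    obtain ⟨p, q, rfl⟩ := hx
    obtain ⟨p', q', rfl⟩ := hy
    refine ⟨p * p' + d * (q * q'), p * q' + q * p', ?_⟩
    simp only [map_add, map_mul, ← hs]
    ring

theorem linearIndependent_one_sqrt {d : K} (hd : ¬ IsSquare d) {s : E}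
    (hs : s ^ 2 = algebraMap K E d) : LinearIndependent K ![(1 : E), s] := by
  rw [LinearIndependent.pair_iff]
  intro p q h
  rw [Algebra.smul_def, Algebra.smul_def, mul_one] at h
  have hq : q = 0 := by
    by_contra hq
    refine hd ⟨p / q, (algebraMap K E).injective ?_⟩
    have hq' : algebraMap K E q ≠ 0 := by simpa using hq
    rw [← hs, map_mul, map_div₀]
    field_simp
    linear_combination (algebraMap K E q * s - algebraMap K E p) * h
  subst hq
  exact ⟨by simpa using h, rfl⟩

theorem norm_add_mul_sqrt {d : K} (hd : ¬ IsSquare d) {s : E} (hs : s ^ 2 = algebraMap K E d)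
    (hE : IntermediateField.adjoin K {s} = ⊤) (p q : K) :
    Algebra.norm K (algebraMap K E p + algebraMap K E q * s) = p * p - d * (q * q) := by
  have hspan : ⊤ ≤ Submodule.span K (Set.range ![(1 : E), s]) := by
    rintro x -
    obtain ⟨p, q, rfl⟩ := exists_eq_add_mul_of_adjoin_eq_top hs hE x
    rw [Matrix.range_cons, Matrix.range_cons, Matrix.range_empty, Set.union_empty,
      Set.singleton_union, Submodule.mem_span_pair]
    exact ⟨p, q, by rw [Algebra.smul_def, Algebra.smul_def, mul_one]⟩
  let b := Module.Basis.mk (linearIndependent_one_sqrt hd hs) hspan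
  have b0 : b 0 = 1 := by simp [b]
  have b1 : b 1 = s := by simp [b]
  -- `e0` and `e1` give the columns `(p, q)` and `(qd, p)` of multiplication by `p + q s` in the
  -- basis `1, s`.
  have e0 : (algebraMap K E p + algebraMap K E q * s) * b 0 = p • b 0 + q • b 1 := by
    rw [b0, b1, Algebra.smul_def, Algebra.smul_def]; ring
  have e1 : (algebraMap K E p + algebraMap K E q * s) * b 1 = (q * d) • b 0 + p • b 1 := by
    rw [b0, b1, Algebra.smul_def, Algebra.smul_def, map_mul, ← hs]; ring
  rw [Algebra.norm_eq_matrix_det b, Matrix.det_fin_two]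
  simp only [Algebra.leftMulMatrix_eq_repr_mul, e0, e1]
  simp
  ring

theorem mem_normGroup_iff {d : K} (hd : ¬ IsSquare d) {s : E} (hs : s ^ 2 = algebraMap K E d)
    (hE : IntermediateField.adjoin K {s} = ⊤) (n : Kˣ) :
    n ∈ normGroup K E ↔ ∃ p q : K, (n : K) = p * p - d * (q * q) := by
  constructor
  · rintro ⟨x, rfl⟩
    obtain ⟨p, q, h⟩ := exists_eq_add_mul_of_adjoin_eq_top hs hE (x : E)
    exact ⟨p, q, by rw [← norm_add_mul_sqrt hd hs hE, ← h]; rfl⟩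
  · rintro ⟨p, q, h⟩
    -- If `p + q s = 0`, then `n = (p + q s)(p - q s)` would vanish.
    have hx : algebraMap K E p + algebraMap K E q * s ≠ 0 := by
      intro h0
      apply n.ne_zero
      apply (algebraMap K E).injective
      rw [h, map_zero, map_sub, map_mul, map_mul, map_mul, ← hs]
      linear_combination (algebraMap K E p - algebraMap K E q * s) * h0
    rw [← norm_add_mul_sqrt hd hs hE] at h
    exact ⟨Units.mk0 _ hx, Units.ext h.symm⟩

theorem isSquare_units_iff (n : Kˣ) : IsSquare n ↔ IsSquare (n : K) := by
  constructor
  · rintro ⟨s, rfl⟩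
    exact ⟨s, by simp⟩
  · rintro ⟨s, h⟩
    have hs : s ≠ 0 := by rintro rfl; simp at h
    exact ⟨Units.mk0 s hs, Units.ext h⟩

theorem isSquare_mul_inv_units_iff (n γ : Kˣ) :
    IsSquare (n * γ⁻¹) ↔ ∃ s : K, (n : K) = γ * (s * s) := by
  rw [isSquare_units_iff]
  refine exists_congr fun s ↦ ?_
  rw [Units.val_mul, Units.val_inv_eq_inv_val, mul_inv_eq_iff_eq_mul₀ γ.ne_zero, mul_comm (γ : K)]

end QuadraticNorm

/-! ### Norm classes over a local field, and the values of the orbit form -/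

section LocalNorm

variable {F : Type*} [Field F] [ValuativeRel F] [TopologicalSpace F]
  [IsNonarchimedeanLocalField F]

/-- If the two terms have different valuations, the dominant one fixes the square class. If they
agree, cancellation is impossible because `d` is not a square. -/
theorem sq_sub_mul_sq_cases (hp : ringChar 𝓀[F] ≠ 2) {d n p q : F} (hd : ¬ IsSquare d)
    (hn : n ≠ 0) (h : n = p * p - d * (q * q)) :
    (∃ s : F, n = s * s) ∨ (∃ s : F, n = -d * (s * s)) ∨
      (p ≠ 0 ∧ q ≠ 0 ∧ ord n = ord (p * p) ∧ ord n = ord (d * (q * q))) := by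
  have hd0 : d ≠ 0 := by rintro rfl; simp at hd
  by_cases hp0 : p = 0
  · exact .inr (.inl ⟨q, by rw [h, hp0]; ring⟩)
  by_cases hq0 : q = 0
  · exact .inl ⟨p, by rw [h, hq0]; ring⟩
  have hpp := mul_ne_zero hp0 hp0
  have hdq := mul_ne_zero hd0 (mul_ne_zero hq0 hq0)
  rcases lt_trichotomy (ord (p * p)) (ord (d * (q * q))) with hlt | heq | hlt
  · obtain ⟨s, -, hs⟩ := exists_add_eq_mul_sq hp (m := -(d * (q * q))) hpp
      (fun _ ↦ by rwa [ord_neg])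
    exact .inl ⟨p * s, by rw [h, sub_eq_add_neg, hs]; ring⟩
  · have key : ord n = ord (p * p) := by
      apply le_antisymm
      · by_contra! hlt
        -- Cancellation would make `d q² = p² - n` equal to `p²` times a square.
        obtain ⟨s, hs0, hs⟩ := exists_add_eq_mul_sq hp (m := -n) hpp (fun _ ↦ by rwa [ord_neg])
        refine hd ⟨p * s / q, ?_⟩
        field_simp
        linear_combination hs + h
      · by_contra! hlt
        have h1 := (ord_add_eq_left (y := d * (q * q)) hn (fun _ ↦ by rwa [← heq])).2
        rw [h, sub_add_cancel, ← h] at h1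
        omega
    exact .inr (.inr ⟨hp0, hq0, key, key.trans heq⟩)
  · obtain ⟨s, -, hs⟩ := exists_add_eq_mul_sq hp (b := -(d * (q * q))) (m := p * p)
      (neg_ne_zero.2 hdq) (fun _ ↦ by rwa [ord_neg])
    exact .inr (.inl ⟨q * s, by rw [h, sub_eq_neg_add, hs]; ring⟩)

theorem ord_mul_self {x : F} (hx : x ≠ 0) : ord (x * x) = 2 * ord x := by
  rw [ord_mul hx hx]; ring

/-- The values of the norm form of a quadratic extension make up exactly two square classes. -/
theorem exists_sq_sub_mul_sq_iff (hp : ringChar 𝓀[F] ≠ 2) {ε ϖ : F} (hε : ε ≠ 0)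
    (hε0 : ord ε = 0) (hεs : ¬ IsSquare ε) (hϖ : ϖ ≠ 0) (hϖ1 : ord ϖ = 1) {d : F}
    (hd : ¬ IsSquare d) :
    ∃ γ : Fˣ, ¬ IsSquare γ ∧ ∀ n : Fˣ,
      (∃ p q : F, (n : F) = p * p - d * (q * q)) ↔ (IsSquare n ∨ IsSquare (n * γ⁻¹)) := by
  have hd0 : d ≠ 0 := by rintro rfl; simp at hd
  rcases Int.even_or_odd (ord d) with he | ho
  -- Unramified case: every norm has even valuation, so the nontrivial class is that of `ε`.
  · refine ⟨Units.mk0 ε hε, by rwa [isSquare_units_iff], fun n ↦ ?_⟩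
    rw [isSquare_mul_inv_units_iff, isSquare_units_iff, Units.val_mk0]
    constructor
    · rintro ⟨p, q, h⟩
      have hev : Even (ord (n : F)) := by
        rcases sq_sub_mul_sq_cases hp hd n.ne_zero h with hs | ⟨s, hs⟩ | ⟨hp0, -, h1, -⟩
        · exact even_ord_of_isSquare n.ne_zero hs
        · have hs0 : s ≠ 0 := by rintro rfl; simp at hs
          rw [hs, ord_mul (neg_ne_zero.2 hd0) (mul_ne_zero hs0 hs0), ord_neg, ord_mul_self hs0]
          exact he.add (even_two_mul _)
        · rw [h1, ord_mul_self hp0]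
          exact even_two_mul _
      obtain ⟨s, -, hs | hs⟩ := exists_eq_mul_sq_of_even hp hε hε0 hεs hϖ hϖ1 n.ne_zero hev
      · exact .inl ⟨s, by rw [hs, one_mul]⟩
      · exact .inr ⟨s, hs⟩
    · rintro (⟨s, hs⟩ | ⟨s, hs⟩)
      · exact ⟨s, 0, by rw [hs]; ring⟩
      · obtain ⟨t, ht, h | h⟩ := exists_eq_mul_sq_of_even hp hε hε0 hεs hϖ hϖ1 hd0 he
        · exact absurd ⟨t, by rw [h, one_mul]⟩ hd
        -- Here `d = ε t²`, and `p² - ε q² = ε` is solvable because it is so over the residue field.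
        · obtain ⟨p, q, hpq⟩ := exists_sq_sub_mul_sq_eq_unit hp hε hε hε0 hε0
          refine ⟨p * s, q * s / t, ?_⟩
          rw [hs, h]
          field_simp
          linear_combination -s ^ 2 * hpq
  -- Ramified case: `p²` and `d q²` have valuations of opposite parity, so only the classes of `1`
  -- and `-d` occur.
  · refine ⟨Units.mk0 (-d) (neg_ne_zero.2 hd0), ?_, fun n ↦ ?_⟩
    · rw [isSquare_units_iff]
      intro h
      have := even_ord_of_isSquare (neg_ne_zero.2 hd0) h
      rw [ord_neg] at this
      exact (Int.not_even_iff_odd.2 ho) this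
    · rw [isSquare_mul_inv_units_iff, isSquare_units_iff, Units.val_mk0]
      constructor
      · rintro ⟨p, q, h⟩
        rcases sq_sub_mul_sq_cases hp hd n.ne_zero h with hs | hs | ⟨hp0, hq0, h1, h2⟩
        · exact .inl hs
        · exact .inr hs
        · rw [h1, ord_mul_self hp0, ord_mul hd0 (mul_ne_zero hq0 hq0), ord_mul_self hq0] at h2
          obtain ⟨k, hk⟩ := ho
          omega
      · rintro (⟨s, hs⟩ | ⟨s, hs⟩)
        · exact ⟨s, 0, by rw [hs]; ring⟩
        · exact ⟨0, s, by rw [hs]; ring⟩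

theorem nilSupport_of_splitsOver (hp : ringChar 𝓀[F] ≠ 2) {ε ϖ : F} (hε : ε ≠ 0)
    (hε0 : ord ε = 0) (hεs : ¬ IsSquare ε) (hϖ : ϖ ≠ 0) (hϖ1 : ord ϖ = 1) {Γ : sl2 F}
    (hΓ : Γ.1.det ≠ 0) (hs : SplitsOver F Γ) :
    nilSupport Γ = {orbitO 1, orbitO ε, orbitO ϖ, orbitO (ε * ϖ)} := by
  have h2 := two_ne_zero_of_residueChar hp
  rw [splitsOver_iff] at hs
  obtain ⟨a, ha⟩ := hs
  rw [mapSl2_self] at ha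
  have ha0 : a ≠ 0 := by
    rintro rfl
    rw [det_eq_of_mem_adOrbit ha, det_tmat] at hΓ
    simp at hΓ
  have hmem (b : F) (hb : b ≠ 0) : ∃ X ∈ adOrbit Γ, X.1 0 1 = b := by
    rw [adOrbit_eq_of_mem ha, exists_mem_adOrbit_zero_one_eq_iff]
    -- The form of `diag(a, -a)` is `-2apq`; take `p = 1` and solve for `q`.
    refine ⟨1, -b / (2 * a), .inl one_ne_zero, ?_⟩
    simp
    field_simp
  rw [nilSupport_eq hp hϖ hϖ1 hΓ]
  ext O
  simp only [Set.mem_ofPred_eq, Set.mem_insert_iff, Set.mem_singleton_iff]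
  constructor
  · rintro ⟨b, hb, -, rfl⟩
    obtain ⟨s, hs, h⟩ := exists_eq_mul_sq hp hε hε0 hεs hϖ hϖ1 hb
    rcases h with rfl | rfl | rfl | rfl <;> rw [orbitO_mul_sq _ hs] <;> simp
  · rintro (rfl | rfl | rfl | rfl)
    exacts [⟨_, one_ne_zero, hmem _ one_ne_zero, rfl⟩, ⟨_, hε, hmem _ hε, rfl⟩,
      ⟨_, hϖ, hmem _ hϖ, rfl⟩, ⟨_, mul_ne_zero hε hϖ, hmem _ (mul_ne_zero hε hϖ), rfl⟩]

/-- The form of `antidiag u v` is `u p² - v q² = u (p² - uv (q/u)²)`. -/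
theorem exists_mem_adOrbit_antidiag_iff {K : Type*} [Field K] {u v b : K} (hu : u ≠ 0)
    (hb : b ≠ 0) : (∃ X ∈ adOrbit (antidiag u v), X.1 0 1 = b) ↔
      ∃ p q : K, b * u⁻¹ = p * p - u * v * (q * q) := by
  rw [exists_mem_adOrbit_zero_one_eq_iff]
  constructor
  · rintro ⟨p, q, -, h⟩
    refine ⟨p, q / u, ?_⟩
    rw [h]
    simp [antidiag]
    field_simp
  · rintro ⟨p, q, h⟩
    refine ⟨p, u * q, ?_, ?_⟩
    · by_contra! h0
      have hq : q = 0 := by simpa [hu] using h0.2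
      rw [h0.1, hq] at h
      simp [hu, hb] at h
    · simp [antidiag]
      field_simp at h
      linear_combination h

end LocalNorm

end SL2Support

theorem lemmaL {F : Type*} [Field F] [ValuativeRel F] [TopologicalSpace F]
    [IsNonarchimedeanLocalField F] (hp : ringChar 𝓀[F] ≠ 2)
    (ε ϖ : F) (hε : val ε = 0) (hε_nonsquare : ¬ IsSquare ε) (hϖ : val ϖ = 1)
    (Γ : sl2 F) (hΓ : Γ ≠ 0) (hΓs : IsSemisimpleElt Γ) :
    (SplitsOver F Γ →
      nilSupport Γ = {orbitO 1, orbitO ε, orbitO ϖ, orbitO (ε * ϖ)}) ∧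
    (¬ SplitsOver F Γ →
      (∃ u v : Fˣ, antidiag (u : F) (v : F) ∈ adOrbit Γ) ∧
      ∀ u v : Fˣ, antidiag (u : F) (v : F) ∈ adOrbit Γ →
        ∀ (E : Type*) [Field E] [Algebra F E] (s : E),
          s ^ 2 = algebraMap F E ((u : F) * (v : F)) →
          IntermediateField.adjoin F {s} = ⊤ →
            SplitsOver E Γ ∧
            (∀ u' v' : Fˣ, antidiag (u' : F) (v' : F) ∈ adOrbit Γ →
              u' * u⁻¹ ∈ normGroup F E ∧ v' * v⁻¹ ∈ normGroup F E) ∧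
            (∃ γ : Fˣ, RepresentedByOneAnd (normGroup F E) γ) ∧
            ∀ γ : Fˣ, RepresentedByOneAnd (normGroup F E) γ →
              nilSupport Γ = {orbitO (u : F), orbitO ((u : F) * (γ : F))}) := by
  have h2 := two_ne_zero_of_residueChar hp
  have hε' : ε ≠ 0 := by rintro rfl; exact hε_nonsquare (IsSquare.zero)
  have hϖ' : ϖ ≠ 0 := by rintro rfl; exact EReal.coe_ne_top 1 (by simpa [val] using hϖ.symm)
  have hε0 : ord ε = 0 := by rw [val_of_ne_zero hε'] at hε; exact_mod_cast hε
  have hϖ1 : ord ϖ = 1 := by rw [val_of_ne_zero hϖ'] at hϖ; exact_mod_cast hϖ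
  have hdet : Γ.1.det ≠ 0 := det_ne_zero_of_isSemisimpleElt hϖ' hϖ1 hΓ hΓs
  refine ⟨nilSupport_of_splitsOver hp hε' hε0 hε_nonsquare hϖ' hϖ1 hdet, fun hns ↦
    ⟨exists_antidiag_mem_adOrbit h2 hdet hns, ?_⟩⟩
  intro u v huv E _ _ s hs hE
  have hΓo : adOrbit Γ = adOrbit (antidiag (u : F) (v : F)) := (adOrbit_eq_of_mem huv).symm
  have hd : ¬ IsSquare ((u : F) * (v : F)) := by
    rintro ⟨r, hr⟩
    exact hns ((splitsOver_antidiag h2 u.ne_zero v.ne_zero (E := F) (s := r)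
      (by rw [hr, pow_two]; rfl)).of_mem_adOrbit (mem_adOrbit_symm huv))
  have hN := mem_normGroup_iff hd hs hE
  -- The unit entries `b` form the coset `u · N(Eˣ)`, which yields both the uniqueness of `u` and
  -- the support.
  have hentry (b : Fˣ) : (∃ X ∈ adOrbit Γ, X.1 0 1 = (b : F)) ↔ b * u⁻¹ ∈ normGroup F E := by
    rw [hN, hΓo, exists_mem_adOrbit_antidiag_iff u.ne_zero b.ne_zero]
    simp
  refine ⟨(splitsOver_antidiag h2 u.ne_zero v.ne_zero hs).of_mem_adOrbit (mem_adOrbit_symm huv),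
    fun u' v' huv' ↦ ⟨(hentry u').1 ⟨_, huv', rfl⟩, ?_⟩, ?_, ?_⟩
  -- A Weyl conjugate has upper right entry `-y`, so `-y / u` is a norm; dividing two such norms
  -- compares `v'` with `v`.
  · have hlower {x y : Fˣ} (h : antidiag (x : F) (y : F) ∈ adOrbit Γ) :
        -y * u⁻¹ ∈ normGroup F E := by
      obtain ⟨Y, hY, -, h01, -⟩ := exists_mem_adOrbit_neg_lower (antidiag (x : F) (y : F))
      rw [adOrbit_eq_of_mem h] at hY
      exact (hentry (-y)).1 ⟨Y, hY, by rw [h01]; rfl⟩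
    have h := mul_mem (hlower huv') (inv_mem (hlower huv))
    have e : -v' * u⁻¹ * (-v * u⁻¹)⁻¹ = v' * v⁻¹ := by
      apply Units.ext
      push_cast
      field_simp
    rwa [e] at h
  · obtain ⟨γ, hγ, h⟩ := exists_sq_sub_mul_sq_iff hp hε' hε0 hε_nonsquare hϖ' hϖ1 hd
    exact ⟨γ, hγ, fun n ↦ (hN n).trans (h n)⟩
  · rintro γ ⟨-, hγ⟩
    rw [nilSupport_eq hp hϖ' hϖ1 hdet]
    ext O
    simp only [Set.mem_ofPred_eq, Set.mem_insert_iff, Set.mem_singleton_iff]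
    constructor
    · rintro ⟨b, hb, hX, rfl⟩
      lift b to Fˣ using hb.isUnit
      -- Membership of `b / u` in the norm group says that `b` is `u` or `uγ` up to a square.
      rw [hentry, hγ, isSquare_mul_inv_units_iff, mul_assoc, ← mul_inv,
        isSquare_mul_inv_units_iff] at hX
      have hs0 {x y : F} (h : (b : F) = y * (x * x)) : x ≠ 0 := by
        rintro rfl
        simp at h
      rcases hX with ⟨x, hx⟩ | ⟨x, hx⟩
      · exact .inl (by rw [hx, orbitO_mul_sq _ (hs0 hx)])
      · exact .inr (by rw [hx, orbitO_mul_sq _ (hs0 hx), Units.val_mul])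
    · rintro (rfl | rfl)
      · exact ⟨u, u.ne_zero, ⟨_, huv, rfl⟩, rfl⟩
      · refine ⟨(u * γ : Fˣ), (u * γ).ne_zero, (hentry _).2 ?_, by rw [Units.val_mul]⟩
        rw [mul_inv_cancel_comm, hγ]
        exact .inr (by simp)
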